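/- **Theorem 1.** The LTL model-checking problem for hybrid Kripke structures is undecidable. A *hybrid automaton* has finite sets $M$ of modes, $\Sigma$ of actions and $X$ of real variables, a set of initial modes $M_0\subseteq M$, a set of initial valuations $V_0\subseteq\mathbb R^X$, an invariant $I(m)\subseteq\mathbb R^X$ and a Lipschitz-continuous flow $F(m):\mathbb R^X\to\mathbb R^X$ for every mode $m$, and a set of transitions $(m,g,a,j,m')$ with guard $g\subseteq\mathbb R^X$, $a\in\Sigma$, and jump relation $j\subseteq\mathbb R^X\times\mathbb R^X$. From a configuration $(m,\nu)$ there is a step labelled $(t,a)\in\mathbb R_{\ge 0}\times\Sigma$ to $(m',\nu')$ if for some transition $(m,g,a,j,m')$ the solution $f$ of $\dot x=F(m)(x)$, $f(0)=\nu$, satisfies $f(\tau)\in I(m)$ for all $\tau\in[0,t]$, $f(t)\in g$, $(f(t),\nu')\in j$ and $\nu'\in I(m')$. Runs are finite or infinite sequences of steps that start in some $(m_0,\nu_0)$ with $m_0\in M_0$, $\nu_0\in V_0\cap I(m_0)$. A *hybrid Kripke structure* $\mathcal K$ is a hybrid automaton with a finite set $P$ of atomic propositions and a labelling $L:M\to 2^P$.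 For an LTL formula $\varphi ::= \mathit{true}\mid p\mid \varphi\wedge\varphi\mid\neg\varphi\mid\varphi\,\mathcal U\,\varphi$ with $p \in P$, write $\mathcal K\models\varphi$ if the label sequence of every run of $\mathcal K$ satisfies $\varphi$. A *multi-rate* structure is one in which guards and invariants are finite conjunctions of constraints $x\bowtie c$ with $x\in X$, $c\in\mathbb N$, $\bowtie\in\{<,\le,=,\ge,>\}$, jumps reset some of the variables to integers and leave the others unchanged, every variable has in every mode a constant integer rate, all variables are initially $0$, and there are finitely many transitions; such a structure is described by finite data. Let hybrid Kripke structures be presented by codes, in any effective way in which at least the finite descriptions of multi-rate structures can be translated computably into codes of the structures that they describe. Then there is no computable function that, given a code of a hybrid Kripke structure $\mathcal K$ and an LTL formula $\varphi$ over its atomic propositions, decides whether $\mathcal K\models\varphi$. This holds whether "every run" means all finite and infinite runs, only the infinite runs, or only the maximal runs (the infinite ones and the finite ones that cannot be extended), and whether the position witnessing $\varphi\,\mathcal U\,\psi$ is required to lie strictly in the future or may be the current one. -/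

import Mathlib

open scoped NNReal

/-! ## State transition graphs, runs and Kripke structures -/

/-- A state transition graph with states `S` and actions `A`. -/
structure TransitionGraph (S A : Type*) where
  /-- the initial states -/
  init : Set S
  /-- the labelled transition relation -/
  Trans : S → A → S → Prop

/-- A finite or infinite run, starting in an initial state.  `last` is the index of its last state
(`⊤` if the run is infinite); the values of `state` beyond `last` are irrelevant. -/
structure TransitionGraph.Run {S A : Type*} (T : TransitionGraph S A) where
  last : ℕ∞
  state : ℕ → S
  act : ∀ i : ℕ, (i : ℕ∞) < last → A
  start : state 0 ∈ T.init
  step : ∀ (i : ℕ) (h : (i : ℕ∞) < last), T.Trans (state i) (act i h) (state (i + 1))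

/-- The usual conventions on which runs of a system are its behaviours. -/
inductive RunKind
  /-- all finite and infinite runs -/
  | all
  /-- the infinite runs only -/
  | infinite
  /-- the infinite runs, and the finite runs that end in a state without outgoing transition -/
  | maximal

/-- `k.Admits r`: the run `r` counts as a behaviour under the convention `k`. -/
def RunKind.Admits {S A : Type*} {T : TransitionGraph S A} : RunKind → T.Run → Prop
  | .all, _ => True
  | .infinite, r => r.last = ⊤
  | .maximal, r => ∀ n : ℕ, r.last = n → ∀ a s, ¬ T.Trans (r.state n) a s

/-- A Kripke structure: a state transition graph, a finite set `props` of atomic propositions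
(their names are natural numbers) and a labelling of the states by subsets of `props`. -/
structure KripkeStructure (S A : Type*) where
  graph : TransitionGraph S A
  props : Finset ℕ
  label : S → Set ℕ
  label_subset : ∀ s, label s ⊆ props

/-! ## Linear temporal logic -/

/-- LTL formulas over atomic propositions named by natural numbers. -/
inductive LTL : Type
  | tt : LTL
  | atom : ℕ → LTL
  | neg : LTL → LTL
  | conj : LTL → LTL → LTL
  | untl : LTL → LTL → LTL

namespace LTL

/-- The atomic propositions that occur in a formula. -/
def atoms : LTL → Finset ℕ
  | tt => ∅
  | atom p => {p}
  | neg φ => φ.atoms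
  | conj φ ψ => φ.atoms ∪ ψ.atoms
  | untl φ ψ => φ.atoms ∪ ψ.atoms

/-- The standard bijective Gödel numbering of formulas. -/
def encodeLTL : LTL → ℕ
  | tt => 0
  | atom p => 4 * p + 1
  | neg φ => 4 * encodeLTL φ + 2
  | conj φ ψ => 4 * Nat.pair (encodeLTL φ) (encodeLTL ψ) + 3
  | untl φ ψ => 4 * Nat.pair (encodeLTL φ) (encodeLTL ψ) + 4

/-- The inverse of `encodeLTL`. -/
def ofNatLTL : ℕ → LTL
  | 0 => tt
  | n + 1 =>
    have h0 : n / 4 < n + 1 := Nat.lt_succ_of_le (Nat.div_le_self n 4)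
    have _h1 : (n / 4).unpair.1 < n + 1 := lt_of_le_of_lt (Nat.unpair_left_le _) h0
    have _h2 : (n / 4).unpair.2 < n + 1 := lt_of_le_of_lt (Nat.unpair_right_le _) h0
    match n % 4 with
    | 0 => atom (n / 4)
    | 1 => neg (ofNatLTL (n / 4))
    | 2 => conj (ofNatLTL (n / 4).unpair.1) (ofNatLTL (n / 4).unpair.2)
    | _ => untl (ofNatLTL (n / 4).unpair.1) (ofNatLTL (n / 4).unpair.2)

theorem ofNatLTL_encodeLTL (φ : LTL) : ofNatLTL (encodeLTL φ) = φ := by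
  induction φ with
  | tt => simp [encodeLTL, ofNatLTL]
  | atom p =>
    have h1 : 4 * p % 4 = 0 := by omega
    have h2 : 4 * p / 4 = p := by omega
    simp only [encodeLTL, ofNatLTL, h1, h2]
  | neg φ ih =>
    have h1 : (4 * encodeLTL φ + 1) % 4 = 1 := by omega
    have h2 : (4 * encodeLTL φ + 1) / 4 = encodeLTL φ := by omega
    simp only [encodeLTL, ofNatLTL, h1, h2, ih]
  | conj φ ψ ih1 ih2 =>
    have h1 : (4 * Nat.pair (encodeLTL φ) (encodeLTL ψ) + 2) % 4 = 2 := by omega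
    have h2 : (4 * Nat.pair (encodeLTL φ) (encodeLTL ψ) + 2) / 4
        = Nat.pair (encodeLTL φ) (encodeLTL ψ) := by omega
    simp only [encodeLTL, ofNatLTL, h1, h2, Nat.unpair_pair, ih1, ih2]
  | untl φ ψ ih1 ih2 =>
    have h1 : (4 * Nat.pair (encodeLTL φ) (encodeLTL ψ) + 3) % 4 = 3 := by omega
    have h2 : (4 * Nat.pair (encodeLTL φ) (encodeLTL ψ) + 3) / 4
        = Nat.pair (encodeLTL φ) (encodeLTL ψ) := by omega
    simp only [encodeLTL, ofNatLTL, h1, h2, Nat.unpair_pair, ih1, ih2]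

theorem encodeLTL_ofNatLTL (n : ℕ) : encodeLTL (ofNatLTL n) = n := by
  induction n using Nat.strong_induction_on with
  | _ n ih =>
    cases n with
    | zero => simp [encodeLTL, ofNatLTL]
    | succ n =>
      have h0 : n / 4 < n + 1 := Nat.lt_succ_of_le (Nat.div_le_self n 4)
      have e0 := ih _ h0
      have e1 := ih _ (lt_of_le_of_lt (Nat.unpair_left_le (n / 4)) h0)
      have e2 := ih _ (lt_of_le_of_lt (Nat.unpair_right_le (n / 4)) h0)
      rw [ofNatLTL]
      have hlt : n % 4 < 4 := Nat.mod_lt _ (by norm_num)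
      have hd := Nat.div_add_mod n 4
      generalize n % 4 = r at hlt hd ⊢
      interval_cases r <;> simp only [encodeLTL, e0, e1, e2, Nat.pair_unpair] <;> omega

instance instDenumerable : Denumerable LTL :=
  Denumerable.mk' ⟨encodeLTL, ofNatLTL, ofNatLTL_encodeLTL, encodeLTL_ofNatLTL⟩

end LTL

/-- The two usual conventions for the until operator: its witness position lies strictly in the
future, or it may also be the current position. -/
inductive UntilKind
  | strict
  | reflexive

/-- The least admissible distance of the witness of an until formula. -/
def UntilKind.least : UntilKind → ℕ
  | .strict => 1
  | .reflexive => 0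

/-- `φ.Sat u N w k`: the formula holds at position `k` of the trace `w 0, w 1, …` whose last
position is `N` (`⊤` if it is infinite). -/
def LTL.Sat (u : UntilKind) (N : ℕ∞) (w : ℕ → Set ℕ) : LTL → ℕ → Prop
  | .tt, _ => True
  | .atom p, k => p ∈ w k
  | .neg φ, k => ¬ LTL.Sat u N w φ k
  | .conj φ ψ, k => LTL.Sat u N w φ k ∧ LTL.Sat u N w ψ k
  | .untl φ ψ, k => ∃ j : ℕ, u.least ≤ j ∧ ((k + j : ℕ) : ℕ∞) ≤ N ∧
      LTL.Sat u N w ψ (k + j) ∧ ∀ i < j, LTL.Sat u N w φ (k + i)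

/-- `K ⊨ φ`: the trace of every run of `K` satisfies `φ` at position `0`. -/
def KripkeStructure.Models {S A : Type*} (K : KripkeStructure S A) (r : RunKind) (u : UntilKind)
    (φ : LTL) : Prop :=
  ∀ ρ : K.graph.Run, r.Admits ρ → φ.Sat u ρ.last (fun i => K.label (ρ.state i)) 0

/-! ## Hybrid automata and hybrid Kripke structures -/

/-- A transition `(m, g, a, j, m')` of a hybrid automaton with modes `M`, actions `A` and
variables `X`; predicates are sets of valuations, and the jump predicate is a set of pairs of a
current and a next valuation. -/
structure HybridEdge (M A X : Type) where
  source : M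
  guard : Set (X → ℝ)
  action : A
  jump : Set ((X → ℝ) × (X → ℝ))
  target : M

/-- Hybrid automata.  (On `Var → ℝ` with `Var` finite all norms are equivalent, so
Lipschitz continuity does not depend on the choice of the norm.) -/
structure HybridAutomaton where
  Mode : Type
  Act : Type
  Var : Type
  [finiteMode : Finite Mode]
  [finiteAct : Finite Act]
  [fintypeVar : Fintype Var]
  /-- the initial modes -/
  initMode : Set Mode
  /-- the transitions -/
  edges : Set (HybridEdge Mode Act Var)
  /-- the mode invariants -/
  inv : Mode → Set (Var → ℝ)
  /-- the flow functions: in mode `m` the variables obey the differential equation `ẋ = flow m x` -/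
  flow : Mode → (Var → ℝ) → (Var → ℝ)
  lipschitz : ∀ m, ∃ K : ℝ≥0, LipschitzWith K (flow m)
  /-- the initial valuations -/
  initVal : Set (Var → ℝ)

/-- `f : [0, ∞) → ℝ^X` solves `ẋ = F(x)` with initial value `ν` (values of `f` at negative times are
irrelevant). -/
def IsFlowSolution {X : Type} (F : (X → ℝ) → (X → ℝ)) (ν : X → ℝ) (f : ℝ → X → ℝ) : Prop :=
  f 0 = ν ∧ ∀ t : ℝ, 0 ≤ t → ∀ x : X, HasDerivWithinAt (fun s => f s x) (F (f t) x) (Set.Ici 0) t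

/-- The state transition graph of a hybrid automaton.  A state is a mode with a valuation; a
transition with label `(t, a)` lets time `t` pass in the mode `m`, within its invariant, and then
executes an `a`-edge.  The solution `f` is unique because the flow is Lipschitz. -/
def HybridAutomaton.graph (H : HybridAutomaton) :
    TransitionGraph (H.Mode × (H.Var → ℝ)) (ℝ≥0 × H.Act) where
  init := {s | s.1 ∈ H.initMode ∧ s.2 ∈ H.initVal ∧ s.2 ∈ H.inv s.1}
  Trans s l s' := ∃ e ∈ H.edges, e.source = s.1 ∧ e.action = l.2 ∧ e.target = s'.1 ∧
    ∃ f : ℝ → H.Var → ℝ, IsFlowSolution (H.flow s.1) s.2 f ∧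
      f l.1 ∈ e.guard ∧
      (∀ τ ∈ Set.Icc (0 : ℝ) l.1, f τ ∈ H.inv s.1) ∧
      (f l.1, s'.2) ∈ e.jump ∧
      s'.2 ∈ H.inv s'.1

/-- Hybrid Kripke structures: hybrid automata with a finite set of atomic propositions and a
labelling of the modes by subsets of it. -/
structure HybridKripke extends HybridAutomaton where
  props : Finset ℕ
  label : Mode → Set ℕ
  label_subset : ∀ m, label m ⊆ props

/-- The (infinite-state) Kripke structure that is the semantics of a hybrid Kripke structure. -/
def HybridKripke.toKripke (K : HybridKripke) :
    KripkeStructure (K.Mode × (K.Var → ℝ)) (ℝ≥0 × K.Act) where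
  graph := K.toHybridAutomaton.graph
  props := K.props
  label s := K.label s.1
  label_subset s := K.label_subset s.1

/-- `K ⊨ φ` for a hybrid Kripke structure. -/
def HybridKripke.Models (K : HybridKripke) (r : RunKind) (u : UntilKind) (φ : LTL) : Prop :=
  K.toKripke.Models r u φ

/-! ## Finite descriptions of multi-rate hybrid Kripke structures -/

/-- Comparison symbols. -/
inductive Cmp
  | lt
  | le
  | eq
  | ge
  | gt

namespace Cmp

/-- The comparison of real numbers denoted by a symbol. -/
def Holds : Cmp → ℝ → ℝ → Prop
  | lt, a, b => a < b
  | le, a, b => a ≤ b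
  | eq, a, b => a = b
  | ge, a, b => b ≤ a
  | gt, a, b => b < a

/-- Numbering of the comparison symbols. -/
def equivFin : Cmp ≃ Fin 5 where
  toFun
    | lt => 0
    | le => 1
    | eq => 2
    | ge => 3
    | gt => 4
  invFun
    | 0 => lt
    | 1 => le
    | 2 => eq
    | 3 => ge
    | 4 => gt
  left_inv c := by cases c <;> rfl
  right_inv i := by fin_cases i <;> rfl

instance instPrimcodable : Primcodable Cmp := Primcodable.ofEquiv (Fin 5) equivFin

end Cmp

/-- A rectangular predicate: a finite conjunction of constraints `x ⋈ c`, each given by the index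
of the variable `x`, the comparison `⋈` and the constant `c ∈ ℕ`. -/
abbrev RectPred : Type := List (ℕ × Cmp × ℕ)

/-- The valuations of `n` variables that satisfy a rectangular predicate. -/
def RectPred.toSet (g : RectPred) (n : ℕ) : Set (Fin n → ℝ) :=
  {ν | ∀ k ∈ g, ∀ x : Fin n, x.val = k.1 → k.2.1.Holds (ν x) k.2.2}

/-- The jump predicate of a list of resets `x' = c` (`c ∈ ℤ`); all other variables keep their
values. -/
def resetJump (l : List (ℕ × ℤ)) (n : ℕ) : Set ((Fin n → ℝ) × (Fin n → ℝ)) :=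
  {p | ∀ x : Fin n, (∀ k ∈ l, k.1 = x.val → p.2 x = k.2) ∧
    ((∀ k ∈ l, k.1 ≠ x.val) → p.2 x = p.1 x)}

/-- Finite description of a transition of a multi-rate hybrid automaton. -/
structure MultiRateEdge where
  source : ℕ
  guard : RectPred
  action : ℕ
  resets : List (ℕ × ℤ)
  target : ℕ

/-- A transition description is a tuple of finite data. -/
def MultiRateEdge.equivProd : MultiRateEdge ≃ ℕ × RectPred × ℕ × List (ℕ × ℤ) × ℕ where
  toFun e := (e.source, e.guard, e.action, e.resets, e.target)
  invFun p := ⟨p.1, p.2.1, p.2.2.1, p.2.2.2.1, p.2.2.2.2⟩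
  left_inv _ := rfl
  right_inv _ := rfl

instance MultiRateEdge.instPrimcodable : Primcodable MultiRateEdge :=
  Primcodable.ofEquiv _ MultiRateEdge.equivProd

/-- Finite description of a multi-rate hybrid Kripke structure.  Modes, actions and variables are
numbered from `0`; the `i`-th entries of `invs`, `rates`, `labels` belong to the mode `i`, and the
`j`-th entry of an entry of `rates` is the rate of the variable `j`. -/
structure MultiRate where
  numModes : ℕ
  numActs : ℕ
  numVars : ℕ
  initModes : List ℕ
  edges : List MultiRateEdge
  invs : List RectPred
  rates : List (List ℤ)
  props : List ℕ
  labels : List (List ℕ)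

namespace MultiRate

/-- A description is a tuple of finite data. -/
def equivProd : MultiRate ≃ ℕ × ℕ × ℕ × List ℕ × List MultiRateEdge × List RectPred ×
    List (List ℤ) × List ℕ × List (List ℕ) where
  toFun p := (p.numModes, p.numActs, p.numVars, p.initModes, p.edges, p.invs, p.rates, p.props,
    p.labels)
  invFun q := ⟨q.1, q.2.1, q.2.2.1, q.2.2.2.1, q.2.2.2.2.1, q.2.2.2.2.2.1, q.2.2.2.2.2.2.1,
    q.2.2.2.2.2.2.2.1, q.2.2.2.2.2.2.2.2⟩
  left_inv _ := rfl
  right_inv _ := rfl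

instance instPrimcodable : Primcodable MultiRate := Primcodable.ofEquiv _ equivProd

/-- The hybrid Kripke structure with a given description: rectangular guards and invariants, jumps
that reset variables to integers, constant integer rates, and all variables initially `0`.
Entries that refer to modes, actions, variables or propositions out of range are ignored; missing
entries mean the trivial invariant, rate `0` and the empty label. -/
def toHybridKripke (p : MultiRate) : HybridKripke where
  Mode := Fin p.numModes
  Act := Fin p.numActs
  Var := Fin p.numVars
  initMode := {m | m.val ∈ p.initModes}
  edges := {e | ∃ d ∈ p.edges, e.source.val = d.source ∧ e.guard = d.guard.toSet p.numVars ∧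
    e.action.val = d.action ∧ e.jump = resetJump d.resets p.numVars ∧ e.target.val = d.target}
  inv m := (p.invs.getD m.val []).toSet p.numVars
  flow m _ x := (((p.rates.getD m.val []).getD x.val 0 : ℤ) : ℝ)
  lipschitz _ := ⟨0, LipschitzWith.const _⟩
  initVal := {fun _ => 0}
  props := p.props.toFinset
  label m := {a | a ∈ p.props ∧ a ∈ p.labels.getD m.val []}
  label_subset _ a ha := by simpa using ha.1

end MultiRate

/-! ## Counter programs -/

/-! The halting problem is reduced to model checking of the formula ¬(true U p), with p holding
exactly in the mode of a final program node. Every partial recursive function is computed by a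
nondeterministic counter program (`programmable_of_partrec'`). Correctness has two halves: every
completed execution returns the right value, and a completed execution exists whenever the function
is defined. Wrong guesses merely block. So a program for "run the code n on 0" can be completed
exactly when that computation halts, which is undecidable in n (`exists_undecidable`).

Structured programs become finite flowcharts (`Flowchart.exists_of_counterProg`), and flowcharts
become multi-rate structures. Nodes turn into modes, registers into variables, and each instruction
takes one unit of time measured by a clock: a register moves with rate 1, -1 or 0, the guard at time
1 tests it, and a jump resets the clock. Flows are then affine, so transitions match flowchart steps
exactly (`trans_of_step`, `step_of_trans`). The input n enters only as a reset constant on the first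
edge, which makes the reduction computable.

A loop at the final mode makes every halting computation an infinite run, while non-halting excludes
p from all runs, finite ones included. The initial mode never carries p. Hence `models_iff` holds
for every convention on runs and on until. -/

/-- The elementary instructions of counter programs with registers numbered from `0`. -/
inductive CounterAct
  | nop
  | inc (x : ℕ)
  | dec (x : ℕ)
  | isZero (x : ℕ)
  | clear (x : ℕ)

/-- The effect of an instruction on the contents of the registers. -/
def CounterAct.Rel : CounterAct → (ℕ → ℕ) → (ℕ → ℕ) → Prop
  | nop, s, t => t = s
  | inc x, s, t => t = Function.update s x (s x + 1)
  | dec x, s, t => s x ≠ 0 ∧ t = Function.update s x (s x - 1)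
  | isZero x, s, t => s x = 0 ∧ t = s
  | clear x, s, t => t = Function.update s x 0

/-- Nondeterministic structured counter programs. -/
inductive CounterProg
  | act (a : CounterAct)
  | seq (P Q : CounterProg)
  | star (P : CounterProg)

namespace CounterProg

/-- The input-output relation of a program. -/
def Rel : CounterProg → (ℕ → ℕ) → (ℕ → ℕ) → Prop
  | act a => a.Rel
  | seq P Q => Relation.Comp P.Rel Q.Rel
  | star P => Relation.ReflTransGen P.Rel

theorem star_invariant {P : CounterProg} {I : (ℕ → ℕ) → Prop}
    (hP : ∀ s t, I s → P.Rel s t → I t) {s t : ℕ → ℕ} (hs : I s) (h : P.star.Rel s t) : I t := by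
  change Relation.ReflTransGen P.Rel s t at h
  induction h with
  | refl => exact hs
  | tail _ h ih => exact hP _ _ ih h

/-- Existence half of loop reasoning, `star_invariant` being the correctness half. Followed by a
zero test, `star` acts as a while loop: leaving it too early only blocks. -/
theorem star_terminates {P : CounterProg} (I : (ℕ → ℕ) → Prop) (m : (ℕ → ℕ) → ℕ)
    (hP : ∀ s k, I s → m s = k + 1 → ∃ t, P.Rel s t ∧ I t ∧ m t = k) (s : ℕ → ℕ) (hs : I s) :
    ∃ t, P.star.Rel s t ∧ I t ∧ m t = 0 := by
  obtain ⟨k, hk⟩ : ∃ k, m s = k := ⟨_, rfl⟩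
  induction k generalizing s with
  | zero => exact ⟨s, Relation.ReflTransGen.refl, hs, hk⟩
  | succ k ih =>
    obtain ⟨t, h1, h2, h3⟩ := hP s k hs hk
    obtain ⟨t', h4, h5⟩ := ih t h2 h3
    exact ⟨t', Relation.ReflTransGen.head h1 h4, h5⟩

/-! ### Partial recursive functions as counter programs -/

/-- Running `P` computes `f` from the registers `a` into the register `o` and leaves the other
registers below `b` unchanged. -/
structure Implements {n : ℕ} (P : CounterProg) (f : List.Vector ℕ n →. ℕ) (a : Fin n → ℕ)
    (o b : ℕ) : Prop where
  sound : ∀ s t, P.Rel s t → t o ∈ f (List.Vector.ofFn fun i => s (a i))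
  frame : ∀ s t, P.Rel s t → ∀ x < b, x ≠ o → t x = s x
  total : ∀ s, (f (List.Vector.ofFn fun i => s (a i))).Dom → ∃ t, P.Rel s t

/-- `f` can be computed by a counter program, for every choice of the input registers and of a
different output register, with scratch registers beyond any given bound. -/
def Programmable {n : ℕ} (f : List.Vector ℕ n →. ℕ) : Prop :=
  ∀ (a : Fin n → ℕ) (o b : ℕ), (∀ i, a i < b) → o < b → (∀ i, a i ≠ o) →
    ∃ P : CounterProg, P.Implements f a o b

/-- Reading a register by decrements destroys it. So `x` is drained into `o` and the scratch
register `b` simultaneously, and then `b` is drained back into `x`. Both targets are cleared first,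
since their contents are arbitrary. -/
theorem exists_copy (x o b : ℕ) (hx : x < b) (ho : o < b) (hxo : x ≠ o) :
    ∃ P : CounterProg, (∀ s t, P.Rel s t → t o = s x) ∧
      (∀ s t, P.Rel s t → ∀ z < b, z ≠ o → t z = s z) ∧ ∀ s, ∃ t, P.Rel s t := by
  let B₁ : CounterProg := (act (.dec x)).seq ((act (.inc o)).seq (act (.inc b)))
  let B₂ : CounterProg := (act (.dec b)).seq (act (.inc x))
  let P : CounterProg := (act (.clear o)).seq ((act (.clear b)).seq (B₁.star.seq
    ((act (.isZero x)).seq (B₂.star.seq (act (.isZero b))))))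
  have hB₁ : ∀ s t, B₁.Rel s t → s x = t x + 1 ∧ t o = s o + 1 ∧ t b = s b + 1 ∧
      ∀ z < b, z ≠ o → z ≠ x → t z = s z := by
    rintro s t ⟨u, ⟨h1, rfl⟩, v, rfl, rfl⟩
    refine ⟨?_, ?_, ?_, fun z hz h3 h4 => ?_⟩ <;> grind [Function.update_apply]
  have hB₂ : ∀ s t, B₂.Rel s t → s b = t b + 1 ∧ t x = s x + 1 ∧
      ∀ z < b, z ≠ x → t z = s z := by
    rintro s t ⟨u, ⟨h1, rfl⟩, rfl⟩
    refine ⟨?_, ?_, fun z hz h3 => ?_⟩ <;> grind [Function.update_apply]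
  have hP : ∀ s t, P.Rel s t → t o = s x ∧ ∀ z < b, z ≠ o → t z = s z := by
    rintro s t ⟨u₁, rfl, u₂, rfl, u₃, h3, u₄, ⟨h4, rfl⟩, u₅, h5, h6, rfl⟩
    have i₁ := star_invariant (I := fun u => u o + u x = s x ∧ u b + u x = s x ∧
      ∀ z < b, z ≠ o → z ≠ x → u z = s z) (by
        rintro p q ⟨e1, e2, e3⟩ hpq
        obtain ⟨k1, k2, k3, k4⟩ := hB₁ p q hpq
        exact ⟨by omega, by omega, fun z a1 a2 a3 => (k4 z a1 a2 a3).trans (e3 z a1 a2 a3)⟩)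
      (by
        refine ⟨?_, ?_, fun z hz h3 h4 => ?_⟩ <;> grind [Function.update_apply]) h3
    have i₂ := star_invariant (I := fun u => u o = s x ∧ u b + u x = s x ∧
      ∀ z < b, z ≠ o → z ≠ x → u z = s z) (by
        rintro p q ⟨e1, e2, e3⟩ hpq
        obtain ⟨k1, k2, k3⟩ := hB₂ p q hpq
        exact ⟨by rw [k3 o ho hxo.symm, e1], by omega,
          fun z a1 a2 a3 => (k3 z a1 a3).trans (e3 z a1 a2 a3)⟩)
      ⟨by omega, by omega, i₁.2.2⟩ h5
    refine ⟨i₂.1, fun z hz hzo => ?_⟩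
    by_cases hzx : z = x
    · subst hzx; omega
    · exact i₂.2.2 z hz hzo hzx
  refine ⟨P, fun s t h => (hP s t h).1, fun s t h => (hP s t h).2, fun s => ?_⟩
  obtain ⟨u, hu, -, hu0⟩ := star_terminates (P := B₁) (fun _ => True) (fun s => s x)
    (fun s k _ hk => by
      have : B₁.Rel s _ := ⟨_, ⟨by simp [hk], rfl⟩, _, rfl, rfl⟩
      exact ⟨_, this, trivial, by have := (hB₁ _ _ this).1; omega⟩)
    (Function.update (Function.update s o 0) b 0) trivial
  obtain ⟨v, hv, -, hv0⟩ := star_terminates (P := B₂) (fun _ => True) (fun s => s b)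
    (fun s k _ hk => by
      have : B₂.Rel s _ := ⟨_, ⟨by simp [hk], rfl⟩, rfl⟩
      exact ⟨_, this, trivial, by have := (hB₂ _ _ this).1; omega⟩) u trivial
  exact ⟨v, _, rfl, _, rfl, u, hu, u, ⟨hu0, rfl⟩, v, hv, hv0, rfl⟩

theorem programmable_zero : Programmable (n := 0) fun _ => Part.some 0 := fun a o b _ _ _ =>
  ⟨act (.clear o), by
    rintro s t rfl
    simp, by
    rintro s t rfl x _ hx
    simp [hx], fun s _ => ⟨_, rfl⟩⟩

theorem programmable_get {n : ℕ} (i : Fin n) :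
    Programmable (n := n) fun v => Part.some (v.get i) := fun a o b ha ho hao => by
  obtain ⟨P, h1, h2, h3⟩ := exists_copy (a i) o b (ha i) ho (hao i)
  exact ⟨P, fun s t h => by simp [h1 s t h], h2, fun s _ => h3 s⟩

theorem programmable_succ : Programmable (n := 1) fun v => Part.some v.head.succ :=
    fun a o b ha ho hao => by
  obtain ⟨P, h1, h2, h3⟩ := exists_copy (a 0) o b (ha 0) ho (hao 0)
  refine ⟨P.seq (act (.inc o)), ?_, ?_, ?_⟩
  · rintro s t ⟨u, hu, rfl⟩
    simp [h1 s u hu]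
  · rintro s t ⟨u, hu, rfl⟩ x hx hxo
    simp [hxo, h2 s u hu x hx hxo]
  · intro s _
    obtain ⟨u, hu⟩ := h3 s
    exact ⟨_, u, hu, rfl⟩

theorem _root_.List.Vector.mem_mOfFn_part {α : Type} : ∀ {n : ℕ} (g : Fin n → Part α)
    (v : List.Vector α n), v ∈ List.Vector.mOfFn g ↔ ∀ i, v.get i ∈ g i
  | 0, g, v => by
    have : v = List.Vector.nil := Subsingleton.elim _ _
    simp [List.Vector.mOfFn, this]
  | n + 1, g, v => by
    obtain ⟨x, w, rfl⟩ := v.exists_eq_cons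
    simp only [List.Vector.mOfFn, Fin.forall_fin_succ, List.Vector.get_zero,
      List.Vector.head_cons, List.Vector.get_cons_succ, ← List.Vector.mem_mOfFn_part]
    simp only [Part.bind_eq_bind, Part.pure_eq_some, Part.mem_bind_iff, Part.mem_some_iff]
    constructor
    · rintro ⟨y, hy, w', hw', h⟩
      have h' := congrArg List.Vector.head h
      have h'' := congrArg List.Vector.tail h
      simp only [List.Vector.head_cons, List.Vector.tail_cons] at h' h''
      subst h' h''
      exact ⟨hy, hw'⟩
    · rintro ⟨h1, h2⟩
      exact ⟨x, h1, w, h2, rfl⟩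

/-- The values are stored in `c`, `c + 1`, …; each evaluation raises the bound by one, so that later
scratch work can overwrite neither the inputs nor the results already stored. -/
theorem exists_evalAll {m : ℕ} : ∀ {n : ℕ} (g : Fin n → List.Vector ℕ m →. ℕ),
    (∀ i, Programmable (g i)) → ∀ (a : Fin m → ℕ) (c : ℕ), (∀ i, a i < c) →
    ∃ P : CounterProg,
      (∀ s t, P.Rel s t → ∀ i : Fin n, t (c + i) ∈ g i (List.Vector.ofFn fun i => s (a i))) ∧
      (∀ s t, P.Rel s t → ∀ x < c, t x = s x) ∧
      ∀ s, (∀ i, (g i (List.Vector.ofFn fun i => s (a i))).Dom) → ∃ t, P.Rel s t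
  | 0, g, hg, a, c, ha => by
    refine ⟨act .nop, fun s t _ i => i.elim0, ?_, fun s _ => ⟨s, rfl⟩⟩
    rintro s t rfl x _
    rfl
  | n + 1, g, hg, a, c, ha => by
    obtain ⟨P, hP⟩ := hg 0 a c (c + 1) (fun i => (ha i).trans (Nat.lt_succ_self c))
      (Nat.lt_succ_self c) (fun i => (ha i).ne)
    obtain ⟨Q, h1, h2, h3⟩ := exists_evalAll (fun i => g i.succ) (fun i => hg i.succ) a (c + 1)
      (fun i => (ha i).trans (Nat.lt_succ_self c))
    have key : ∀ s u, P.Rel s u → (fun i => u (a i)) = fun i => s (a i) := fun s u hu =>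
      funext fun i => hP.frame s u hu _ ((ha i).trans (Nat.lt_succ_self c)) (ha i).ne
    refine ⟨P.seq Q, ?_, ?_, ?_⟩
    · rintro s t ⟨u, hu, ht⟩ i
      refine Fin.cases ?_ (fun i => ?_) i
      · have := hP.sound s u hu
        simpa [h2 u t ht c (Nat.lt_succ_self c)] using this
      · have := h1 u t ht i
        rw [key s u hu] at this
        simpa [Nat.add_assoc, Nat.add_comm 1] using this
    · rintro s t ⟨u, hu, ht⟩ x hx
      rw [h2 u t ht x (by omega), hP.frame s u hu x (by omega) (by omega)]
    · intro s hs
      obtain ⟨u, hu⟩ := hP.total s (hs 0)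
      obtain ⟨t, ht⟩ := h3 u (fun i => by rw [key s u hu]; exact hs i.succ)
      exact ⟨t, u, hu, ht⟩

theorem Programmable.comp {m n : ℕ} {f : List.Vector ℕ n →. ℕ}
    {g : Fin n → List.Vector ℕ m →. ℕ} (hf : Programmable f) (hg : ∀ i, Programmable (g i)) :
    Programmable fun v => (List.Vector.mOfFn fun i => g i v) >>= f := fun a o b ha ho _ => by
  obtain ⟨P, h1, h2, h3⟩ := exists_evalAll g hg a b ha
  obtain ⟨Q, hQ⟩ := hf (fun i => b + i) o (b + n) (fun i => by omega) (by omega)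
    (fun i => by omega)
  have key : ∀ s u, P.Rel s u → (List.Vector.ofFn fun i : Fin n => u (b + i)) ∈
      List.Vector.mOfFn fun i => g i (List.Vector.ofFn fun i => s (a i)) := fun s u hu => by
    rw [List.Vector.mem_mOfFn_part]
    intro i
    simpa using h1 s u hu i
  refine ⟨P.seq Q, ?_, ?_, ?_⟩
  · rintro s t ⟨u, hu, ht⟩
    exact Part.mem_bind (key s u hu) (hQ.sound u t ht)
  · rintro s t ⟨u, hu, ht⟩ x hx hxo
    rw [hQ.frame u t ht x (by omega) hxo, h2 s u hu x hx]
  · intro s hs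
    obtain ⟨y, hy⟩ := Part.dom_iff_mem.1 hs
    obtain ⟨v, hv, hy⟩ := Part.mem_bind_iff.1 hy
    obtain ⟨u, hu⟩ := h3 s fun i =>
      Part.dom_iff_mem.2 ⟨_, (List.Vector.mem_mOfFn_part _ v).1 hv i⟩
    obtain ⟨t, ht⟩ := hQ.total u (by
      rw [Part.mem_unique (key s u hu) hv]
      exact Part.dom_iff_mem.2 ⟨y, hy⟩)
    exact ⟨t, u, hu, ht⟩

/-- Register `b` holds the accumulated value, `b + 1` the number of rounds done, `b + 2` the number
of rounds left, and `b + 3` receives the output of `g`. The loop invariant says that `b` holds the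
recursion at stage `b + 1` and that the two round counters add up to the recursion argument. -/
theorem Programmable.prec {n : ℕ} {f : List.Vector ℕ n → ℕ} {g : List.Vector ℕ (n + 2) → ℕ}
    (hf : Programmable fun v => Part.some (f v)) (hg : Programmable fun v => Part.some (g v)) :
    Programmable fun v : List.Vector ℕ (n + 1) =>
      Part.some (v.head.rec (f v.tail) fun y IH => g (y ::ᵥ IH ::ᵥ v.tail) : ℕ) :=
    fun a o b ha ho _ => by
  obtain ⟨F, hF⟩ := hf (fun i => a i.succ) b (b + 4) (fun i => by have := ha i.succ; omega)
    (by omega) (fun i => (ha i.succ).ne)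
  obtain ⟨G, hG⟩ := hg (Fin.cons (b + 1) (Fin.cons b fun i => a i.succ)) (b + 3) (b + 4)
    (by
      refine Fin.cases (by simp) (Fin.cases (by simp) fun i => ?_)
      have := ha i.succ
      simp only [Fin.cons_succ]
      omega) (by omega)
    (by
      refine Fin.cases (by simp) (Fin.cases (by simp) fun i => ?_)
      have := ha i.succ
      simp only [Fin.cons_succ]
      omega)
  obtain ⟨C₁, c1, c2, c3⟩ := exists_copy (a 0) (b + 2) (b + 4) (by have := ha 0; omega)
    (by omega) (by have := ha 0; omega)
  obtain ⟨C₂, d1, d2, d3⟩ := exists_copy (b + 3) b (b + 4) (by omega) (by omega) (by omega)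
  obtain ⟨C₃, e1, e2, e3⟩ := exists_copy b o (b + 4) (by omega) (by omega) (by omega)
  let B : CounterProg := (act (.dec (b + 2))).seq (G.seq (C₂.seq (act (.inc (b + 1)))))
  let P : CounterProg := F.seq ((act (.clear (b + 1))).seq (C₁.seq (B.star.seq
    ((act (.isZero (b + 2))).seq C₃))))
  have hB : ∀ s t, B.Rel s t → s (b + 2) = t (b + 2) + 1 ∧ t (b + 1) = s (b + 1) + 1 ∧
      t b = g (s (b + 1) ::ᵥ s b ::ᵥ List.Vector.ofFn fun i => s (a i.succ)) ∧
      ∀ x < b, t x = s x := by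
    rintro s t ⟨u, ⟨h1, rfl⟩, v, hv, w, hw, rfl⟩
    have k1 : v (b + 3) = g (s (b + 1) ::ᵥ s b ::ᵥ List.Vector.ofFn fun i => s (a i.succ)) := by
      have := Part.mem_some_iff.1 (hG.sound _ _ hv)
      rw [this]
      refine congrArg g ?_
      change _ ::ᵥ _ ::ᵥ (List.Vector.ofFn fun i => _) = _
      congr 2
      · simp
      · simp
      · congr 1
        funext i
        have := ha i.succ
        exact Function.update_of_ne (by simp; omega) _ _
    have k2 : ∀ x < b + 3, v x = if x = b + 2 then s x - 1 else s x := fun x hx => by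
      rw [hG.frame _ _ hv x (by omega) (by omega)]
      grind [Function.update_apply]
    have k3 : ∀ x < b + 4, x ≠ b → w x = v x := d2 v w hw
    refine ⟨?_, ?_, ?_, fun x hx => ?_⟩
    · grind [Function.update_apply]
    · grind [Function.update_apply]
    · rw [← k1, ← d1 v w hw, Function.update_of_ne (by omega)]
    · grind [Function.update_apply]
  have hB' : ∀ s, s (b + 2) ≠ 0 → ∃ t, B.Rel s t := fun s hs => by
    obtain ⟨v, hv⟩ := hG.total (Function.update s (b + 2) (s (b + 2) - 1)) trivial
    obtain ⟨w, hw⟩ := d3 v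
    exact ⟨_, _, ⟨hs, rfl⟩, v, hv, w, hw, rfl⟩
  have hP : ∀ s t, P.Rel s t → t o = ((s (a 0)).rec (f (List.Vector.ofFn fun i => s (a i.succ)))
      fun y IH => g (y ::ᵥ IH ::ᵥ List.Vector.ofFn fun i => s (a i.succ)) : ℕ) ∧
      ∀ x < b, x ≠ o → t x = s x := by
    rintro s t ⟨u₁, h1, u₂, rfl, u₃, h3, u₄, h4, u₅, ⟨h5, rfl⟩, h6⟩
    have k0 := Part.mem_some_iff.1 (hF.sound _ _ h1)
    have k1 := hF.frame _ _ h1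
    have k2 := c1 _ _ h3
    have k3 := c2 _ _ h3
    have inv := star_invariant (I := fun u => (∀ x < b, u x = s x) ∧
      u (b + 1) + u (b + 2) = s (a 0) ∧
      u b = ((u (b + 1)).rec (f (List.Vector.ofFn fun i => s (a i.succ)))
        fun y IH => g (y ::ᵥ IH ::ᵥ List.Vector.ofFn fun i => s (a i.succ)) : ℕ)) (by
        rintro p q ⟨i1, i2, i3⟩ hpq
        obtain ⟨j1, j2, j3, j4⟩ := hB p q hpq
        refine ⟨fun x hx => (j4 x hx).trans (i1 x hx), by omega, ?_⟩
        have : (fun i : Fin n => p (a i.succ)) = fun i => s (a i.succ) :=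
          funext fun i => i1 _ (ha _)
        rw [j3, j2, this, i3]) (by
        refine ⟨fun x hx => ?_, ?_, ?_⟩
        · rw [k3 x (by omega) (by omega), Function.update_of_ne (by omega),
            k1 x (by omega) (by omega)]
        · have := ha 0
          rw [k2, k3 (b + 1) (by omega) (by omega), Function.update_self,
            Function.update_of_ne (by omega), k1 _ (by omega) (by omega), zero_add]
        · rw [k3 (b + 1) (by omega) (by omega), k3 b (by omega) (by omega),
            Function.update_self, Function.update_of_ne (by omega), k0]
          rfl) h4
    obtain ⟨i1, i2, i3⟩ := inv
    refine ⟨?_, fun x hx hxo => ?_⟩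
    · rw [e1 _ _ h6, i3, show u₅ (b + 1) = s (a 0) by omega]
    · rw [e2 _ _ h6 x (by omega) hxo, i1 x hx]
  refine ⟨P, fun s t h => ?_, fun s t h => (hP s t h).2, fun s _ => ?_⟩
  · exact Part.mem_some_iff.2 (hP s t h).1
  · obtain ⟨u, hu⟩ := hF.total s trivial
    obtain ⟨v, hv⟩ := c3 (Function.update u (b + 1) 0)
    obtain ⟨w, hw, -, hw0⟩ := star_terminates (P := B) (fun _ => True) (fun s => s (b + 2))
      (fun s k _ hk => by
        obtain ⟨t, ht⟩ := hB' s (by omega)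
        exact ⟨t, ht, trivial, by have := (hB s t ht).1; omega⟩) v trivial
    obtain ⟨t, ht⟩ := e3 w
    exact ⟨t, u, hu, _, rfl, v, hv, w, hw, w, ⟨hw0, rfl⟩, ht⟩

/-- Register `b` holds the current candidate and `b + 1` the value of `f` there. The decrement
opening the loop body doubles as the test that this value is nonzero; the loop is left through the
zero test. The invariant says that all smaller candidates have nonzero values. -/
theorem Programmable.rfind {n : ℕ} {f : List.Vector ℕ (n + 1) → ℕ}
    (hf : Programmable fun v => Part.some (f v)) :
    Programmable fun v : List.Vector ℕ n =>
      Nat.rfind fun k => Part.some (decide (f (k ::ᵥ v) = 0)) := fun a o b ha ho _ => by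
  obtain ⟨F, hF⟩ := hf (Fin.cons b a) (b + 1) (b + 2)
    (by
      refine Fin.cases (by simp) fun i => ?_
      have := ha i
      simp only [Fin.cons_succ]
      omega) (by omega)
    (by
      refine Fin.cases (by simp) fun i => ?_
      have := ha i
      simp only [Fin.cons_succ]
      omega)
  obtain ⟨C, c1, c2, c3⟩ := exists_copy b o (b + 2) (by omega) (by omega) (by omega)
  let B : CounterProg := (act (.dec (b + 1))).seq ((act (.inc b)).seq F)
  let P : CounterProg := (act (.clear b)).seq (F.seq (B.star.seq
    ((act (.isZero (b + 1))).seq C)))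
  have hF' : ∀ s t, F.Rel s t → t (b + 1) = f (s b ::ᵥ List.Vector.ofFn fun i => s (a i)) ∧
      ∀ x < b + 1, t x = s x := fun s t h =>
    ⟨Part.mem_some_iff.1 (hF.sound s t h), fun x hx => hF.frame s t h x (by omega) (by omega)⟩
  have hB : ∀ s t, B.Rel s t → s (b + 1) ≠ 0 ∧ t b = s b + 1 ∧
      t (b + 1) = f ((s b + 1) ::ᵥ List.Vector.ofFn fun i => s (a i)) ∧ ∀ x < b, t x = s x := by
    rintro s t ⟨u, ⟨h1, rfl⟩, v, rfl, h2⟩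
    obtain ⟨k1, k2⟩ := hF' _ _ h2
    refine ⟨h1, by rw [k2 b (by omega)]; simp, ?_, fun x hx => ?_⟩
    · rw [k1]
      congr 2
      · simp
      · congr 1
        funext i
        have := ha i
        rw [Function.update_of_ne (by omega), Function.update_of_ne (by omega)]
    · rw [k2 x (by omega), Function.update_of_ne (by omega), Function.update_of_ne (by omega)]
  have hB' : ∀ s, s (b + 1) ≠ 0 → ∃ t, B.Rel s t := fun s hs => by
    obtain ⟨t, ht⟩ := hF.total _ trivial
    exact ⟨t, _, ⟨hs, rfl⟩, _, rfl, ht⟩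
  have hstart : ∀ s t, F.Rel (Function.update s b 0) t → (∀ x < b, t x = s x) ∧ t b = 0 ∧
      t (b + 1) = f (0 ::ᵥ List.Vector.ofFn fun i => s (a i)) := fun s t h => by
    obtain ⟨k1, k2⟩ := hF' _ _ h
    refine ⟨fun x hx => ?_, ?_, ?_⟩
    · rw [k2 x (by omega), Function.update_of_ne (by omega)]
    · rw [k2 b (by omega), Function.update_self]
    · rw [k1, Function.update_self]
      congr 3
      funext i
      rw [Function.update_of_ne (ha i).ne]
  have inputs : ∀ {s u : ℕ → ℕ}, (∀ x < b, u x = s x) → (fun i => u (a i)) = fun i => s (a i) :=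
    fun h => funext fun i => h _ (ha i)
  have hP : ∀ s t, P.Rel s t → t o ∈ (Nat.rfind fun k =>
      Part.some (decide (f (k ::ᵥ List.Vector.ofFn fun i => s (a i)) = 0))) ∧
      ∀ x < b, x ≠ o → t x = s x := by
    rintro s t ⟨u₁, rfl, u₂, h2, u₃, h3, u₄, ⟨h4, rfl⟩, h5⟩
    obtain ⟨i1, i2, i3⟩ := star_invariant (I := fun u => (∀ x < b, u x = s x) ∧
      u (b + 1) = f (u b ::ᵥ List.Vector.ofFn fun i => s (a i)) ∧
      (∀ k < u b, f (k ::ᵥ List.Vector.ofFn fun i => s (a i)) ≠ 0)) (by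
        rintro p q ⟨i1, i2, i3⟩ hpq
        obtain ⟨j1, j2, j3, j4⟩ := hB p q hpq
        refine ⟨fun x hx => (j4 x hx).trans (i1 x hx), ?_, fun k hk => ?_⟩
        · rw [j3, j2, inputs i1]
        · rcases Nat.lt_succ_iff_lt_or_eq.1 (j2 ▸ hk) with hk | rfl
          · exact i3 k hk
          -- The newly excluded candidate is `p b`; its value is nonzero because the decrement could
          -- be executed.
          · rwa [← i2]) (by
        obtain ⟨k1, k2, k3⟩ := hstart s u₂ h2
        exact ⟨k1, by rw [k3, k2], by simp [k2]⟩) h3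
    refine ⟨?_, fun x hx hxo => ?_⟩
    · rw [c1 _ _ h5]
      refine Nat.mem_rfind.2 ⟨by simp [← i2, h4], fun {k} hk => by simp [i3 k hk]⟩
    · rw [c2 _ _ h5 x (by omega) hxo, i1 x hx]
  refine ⟨P, fun s t h => (hP s t h).1, fun s t h => (hP s t h).2, fun s hs => ?_⟩
  obtain ⟨N, hN⟩ := Part.dom_iff_mem.1 hs
  obtain ⟨hN1, hN2⟩ := Nat.mem_rfind.1 hN
  obtain ⟨u, hu⟩ := hF.total (Function.update s b 0) trivial
  obtain ⟨k1, k2, k3⟩ := hstart s u hu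
  -- Together with `u b ≤ N`, measure zero means that the candidate has reached the least zero `N`.
  obtain ⟨w, hw, ⟨i1, i2, i3⟩, hw0⟩ := star_terminates (P := B)
    (fun u => (∀ x < b, u x = s x) ∧
      u (b + 1) = f (u b ::ᵥ List.Vector.ofFn fun i => s (a i)) ∧ u b ≤ N) (fun u => N - u b)
    (by
      rintro p k ⟨i1, i2, i3⟩ hk
      have hne : f (p b ::ᵥ List.Vector.ofFn fun i => s (a i)) ≠ 0 := by
        simpa using hN2 (m := p b) (by omega)
      obtain ⟨t, ht⟩ := hB' p (by rwa [i2])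
      obtain ⟨j1, j2, j3, j4⟩ := hB p t ht
      refine ⟨t, ht, ⟨fun x hx => (j4 x hx).trans (i1 x hx), ?_, by omega⟩, by omega⟩
      rw [j3, j2, inputs i1]) u ⟨k1, by rw [k3, k2], by omega⟩
  obtain ⟨t, ht⟩ := c3 w
  refine ⟨t, _, rfl, u, hu, w, hw, w, ⟨?_, rfl⟩, ht⟩
  rw [i2, show w b = N by omega]
  simpa using hN1

theorem programmable_of_primrec' {n : ℕ} {f : List.Vector ℕ n → ℕ} (hf : Nat.Primrec' f) :
    Programmable fun v => Part.some (f v) := by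
  induction hf with
  | zero => exact programmable_zero
  | succ => exact programmable_succ
  | get i => exact programmable_get i
  | comp g _ _ hf hg =>
    have := hf.comp hg
    simpa only [Vector.mOfFn_part_some, Part.bind_eq_bind, Part.bind_some] using this
  | prec _ _ hf hg => exact hf.prec hg

theorem programmable_of_partrec' {n : ℕ} {f : List.Vector ℕ n →. ℕ} (hf : Nat.Partrec' f) :
    Programmable f := by
  induction hf with
  | prim hf => exact programmable_of_primrec' hf
  | comp g _ _ hf hg => exact hf.comp hg
  | rfind _ hf => exact hf.rfind

/-- Some counter program has an undecidable halting problem. -/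
theorem exists_undecidable : ∃ P : CounterProg,
    ¬ ComputablePred fun n : ℕ => ∃ t, P.Rel (Function.update (fun _ => 0) 0 n) t := by
  -- Universality: one fixed program suffices, with the code to be evaluated as its input.
  have h : Partrec fun n : ℕ => Nat.Partrec.Code.eval (Denumerable.ofNat _ n) 0 :=
    Nat.Partrec.Code.eval_part.comp (Computable.ofNat _) (Computable.const 0)
  obtain ⟨P, hP⟩ := programmable_of_partrec' (Nat.Partrec'.part_iff₁.2 h) (fun _ => 0) 1 2
    (by simp) (by simp) (by simp)
  refine ⟨P, fun hc => ComputablePred.halting_problem 0 ?_⟩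
  have := ComputablePred.computable_of_manyOneReducible (p := fun c => (Nat.Partrec.Code.eval c 0).Dom)
    ⟨Encodable.encode, Computable.encode, fun c => ?_⟩ hc
  · exact this
  · constructor
    · intro hd
      exact hP.total _ (by simpa using hd)
    · rintro ⟨t, ht⟩
      have := Part.dom_iff_mem.2 ⟨_, hP.sound _ _ ht⟩
      simpa using this

end CounterProg

/-! ## Flowcharts -/

/-- Nondeterministic flowcharts whose nodes carry instructions. -/
structure Flowchart where
  Node : Type
  [fintypeNode : Fintype Node]
  act : Node → CounterAct
  Edge : Node → Node → Prop
  start : Node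
  final : Node
  act_final : act final = .nop

namespace Flowchart

/-- One step of a flowchart: execute the instruction of the current node and follow an edge. -/
def Step (F : Flowchart) (p q : F.Node × (ℕ → ℕ)) : Prop :=
  F.Edge p.1 q.1 ∧ (F.act p.1).Rel p.2 q.2

/-- The input-output relation of a flowchart. -/
def Rel (F : Flowchart) (s t : ℕ → ℕ) : Prop :=
  Relation.ReflTransGen F.Step (F.start, s) (F.final, t)

/-- The flowchart of a single instruction. -/
def single (a : CounterAct) : Flowchart where
  Node := Bool
  act i := if i then .nop else a
  Edge i j := i = false ∧ j = true
  start := false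
  final := true
  act_final := rfl

theorem single_rel (a : CounterAct) (s t : ℕ → ℕ) : (single a).Rel s t ↔ a.Rel s t := by
  constructor
  · intro h
    rcases Relation.ReflTransGen.cases_head h with h | ⟨⟨j, u⟩, ⟨⟨-, h1⟩, h2⟩, h3⟩
    · simp [single] at h
    · change j = true at h1
      subst h1
      rcases Relation.ReflTransGen.cases_head h3 with h | ⟨_, ⟨⟨h, -⟩, -⟩, -⟩
      · obtain rfl : u = t := congrArg Prod.snd h
        exact h2
      · simp at h
  · intro h
    exact Relation.ReflTransGen.single ⟨⟨rfl, rfl⟩, h⟩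

/-- The edges of the sequential composition of two flowcharts. -/
def seqEdge (F G : Flowchart) : F.Node ⊕ G.Node → F.Node ⊕ G.Node → Prop
  | .inl i, .inl j => F.Edge i j
  | .inr i, .inr j => G.Edge i j
  | .inl i, .inr j => i = F.final ∧ j = G.start
  | .inr _, .inl _ => False

/-- Sequential composition. -/
def seq (F G : Flowchart) : Flowchart where
  Node := F.Node ⊕ G.Node
  fintypeNode := @instFintypeSum _ _ F.fintypeNode G.fintypeNode
  act := Sum.elim F.act G.act
  Edge := seqEdge F G
  start := .inl F.start
  final := .inr G.final
  act_final := G.act_final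

/-- The connecting edge leaves `F.final`, whose instruction is `nop`, so it passes control without
touching the registers. No edge leads back, hence a path splits at its only crossing. -/
theorem seq_rel (F G : Flowchart) (s t : ℕ → ℕ) :
    (F.seq G).Rel s t ↔ Relation.Comp F.Rel G.Rel s t := by
  constructor
  · intro h
    have key : ∀ c : (F.seq G).Node × (ℕ → ℕ),
        Relation.ReflTransGen (F.seq G).Step (.inl F.start, s) c →
        (∃ i, c.1 = .inl i ∧ Relation.ReflTransGen F.Step (F.start, s) (i, c.2)) ∨
        ∃ i, c.1 = .inr i ∧ ∃ u, F.Rel s u ∧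
          Relation.ReflTransGen G.Step (G.start, u) (i, c.2) := by
      intro c hc
      induction hc with
      | refl => exact .inl ⟨_, rfl, .refl⟩
      | @tail c d _ h ih =>
        obtain ⟨c, u⟩ := c
        obtain ⟨d, v⟩ := d
        obtain ⟨h1, h2⟩ := h
        rcases ih with ⟨i, hi, h3⟩ | ⟨i, hi, w, h3, h4⟩
        · change c = _ at hi
          subst hi
          rcases d with j | j
          · exact .inl ⟨j, rfl, h3.tail ⟨h1, h2⟩⟩
          · obtain ⟨rfl, rfl⟩ : i = F.final ∧ j = G.start := h1
            change (F.act F.final).Rel u v at h2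
            rw [F.act_final] at h2
            obtain rfl : v = u := h2
            exact .inr ⟨_, rfl, v, h3, .refl⟩
        · change c = _ at hi
          subst hi
          rcases d with j | j
          · exact h1.elim
          · exact .inr ⟨j, rfl, w, h3, h4.tail ⟨h1, h2⟩⟩
    rcases key _ h with ⟨i, hi, -⟩ | ⟨i, hi, u, h1, h2⟩
    · cases hi
    · obtain rfl : G.final = i := Sum.inr.inj hi
      exact ⟨u, h1, h2⟩
  · rintro ⟨u, h1, h2⟩
    have h1' := Relation.ReflTransGen.lift (r := F.Step) (p := (F.seq G).Step)
      (fun c => (Sum.inl c.1, c.2)) (fun _ _ h => h) _ _ h1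
    have h2' := Relation.ReflTransGen.lift (r := G.Step) (p := (F.seq G).Step)
      (fun c => (Sum.inr c.1, c.2)) (fun _ _ h => h) _ _ h2
    refine (h1'.tail (c := (Sum.inr G.start, u)) ⟨⟨rfl, rfl⟩, ?_⟩).trans h2'
    change (F.act F.final).Rel u u
    rw [F.act_final]
    rfl

/-- The edges of the iteration of a flowchart. -/
def starEdge (F : Flowchart) : Option F.Node → Option F.Node → Prop
  | some i, some j => F.Edge i j
  | none, some j => j = F.start
  | some i, none => i = F.final
  | none, none => False

/-- Iteration. -/
def star (F : Flowchart) : Flowchart where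
  Node := Option F.Node
  fintypeNode := @instFintypeOption _ F.fintypeNode
  act i := i.elim .nop F.act
  Edge := starEdge F
  start := none
  final := none
  act_final := rfl

/-- The extra node is a hub: a path from it decomposes into complete passes through `F`, and both
entering and leaving a pass execute `nop`. -/
theorem star_rel (F : Flowchart) (s t : ℕ → ℕ) :
    F.star.Rel s t ↔ Relation.ReflTransGen F.Rel s t := by
  constructor
  · intro h
    have key : ∀ c : F.star.Node × (ℕ → ℕ),
        Relation.ReflTransGen F.star.Step (none, s) c →
        (c.1 = none ∧ Relation.ReflTransGen F.Rel s c.2) ∨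
        ∃ i, c.1 = some i ∧ ∃ u, Relation.ReflTransGen F.Rel s u ∧
          Relation.ReflTransGen F.Step (F.start, u) (i, c.2) := by
      intro c hc
      induction hc with
      | refl => exact .inl ⟨rfl, .refl⟩
      | @tail c d _ h ih =>
        obtain ⟨c, u⟩ := c
        obtain ⟨d, v⟩ := d
        obtain ⟨h1, h2⟩ := h
        rcases ih with ⟨hi, h3⟩ | ⟨i, hi, w, h3, h4⟩
        · change c = _ at hi
          subst hi
          rcases d with _ | j
          · exact h1.elim
          · obtain rfl : j = F.start := h1
            obtain rfl : v = u := h2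
            exact .inr ⟨_, rfl, v, h3, .refl⟩
        · change c = _ at hi
          subst hi
          rcases d with _ | j
          · obtain rfl : i = F.final := h1
            change (F.act F.final).Rel u v at h2
            rw [F.act_final] at h2
            obtain rfl : v = u := h2
            exact .inl ⟨rfl, h3.tail h4⟩
          · exact .inr ⟨j, rfl, w, h3, h4.tail ⟨h1, h2⟩⟩
    rcases key _ h with ⟨-, h⟩ | ⟨i, hi, -⟩
    · exact h
    · cases hi
  · intro h
    induction h with
    | refl => exact .refl
    | @tail u v _ h ih =>
      have h' := Relation.ReflTransGen.lift (r := F.Step) (p := F.star.Step)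
        (fun c => (some c.1, c.2)) (fun _ _ h => h) _ _ h
      refine ((ih.tail (c := (some F.start, u)) ⟨rfl, rfl⟩).trans h').tail ⟨rfl, ?_⟩
      change (F.act F.final).Rel v v
      rw [F.act_final]
      rfl

theorem exists_of_counterProg (P : CounterProg) : ∃ F : Flowchart, F.Rel = P.Rel := by
  induction P with
  | act a => exact ⟨single a, funext₂ fun s t => propext (single_rel a s t)⟩
  | seq P Q ihP ihQ =>
    obtain ⟨F, hF⟩ := ihP
    obtain ⟨G, hG⟩ := ihQ
    refine ⟨F.seq G, funext₂ fun s t => propext ((seq_rel F G s t).trans ?_)⟩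
    rw [hF, hG]
    rfl
  | star P ih =>
    obtain ⟨F, hF⟩ := ih
    refine ⟨F.star, funext₂ fun s t => propext ((star_rel F s t).trans ?_)⟩
    rw [hF]
    rfl

end Flowchart

/-! ## Multi-rate structures -/

/-- Subtracting the linear drift leaves a function with right derivative zero. -/
theorem IsFlowSolution.eq_of_const {X : Type} {c ν : X → ℝ} {f : ℝ → X → ℝ}
    (hf : IsFlowSolution (fun _ => c) ν f) {t : ℝ} (ht : 0 ≤ t) :
    f t = fun x => ν x + t * c x := by
  funext x
  have hd : ∀ y ∈ Set.Icc 0 t, HasDerivWithinAt (fun s => f s x - s * c x) 0 (Set.Ici 0) y :=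
    fun y hy => by
      have := (hf.2 y hy.1 x).sub ((hasDerivWithinAt_id y (Set.Ici 0)).mul_const (c x))
      exact this.congr_deriv (by simp)
  have h := constant_of_has_deriv_right_zero (f := fun s => f s x - s * c x) (a := 0) (b := t)
    (fun y hy => (hd y hy).continuousWithinAt.mono Set.Icc_subset_Ici_self)
    (fun y hy => (hd y (Set.Ico_subset_Icc_self hy)).mono (Set.Ici_subset_Ici.2 hy.1)) t
    ⟨ht, le_rfl⟩
  have h0 := congrFun hf.1 x
  simp only [zero_mul, sub_zero] at h
  linarith

theorem isFlowSolution_const {X : Type} (c ν : X → ℝ) :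
    IsFlowSolution (fun _ => c) ν fun t x => ν x + t * c x := by
  refine ⟨by simp, fun t _ x => ?_⟩
  simpa using ((hasDerivWithinAt_id t (Set.Ici 0)).mul_const (c x)).const_add (ν x)

/-- The rate of the `x`-th variable in the mode `m`. -/
def MultiRate.rate (p : MultiRate) (m x : ℕ) : ℤ := (p.rates.getD m []).getD x 0

/-- Without invariants every valuation is allowed, and constant rates determine the flow, so the
quantifier over solutions disappears. -/
theorem MultiRate.trans_iff {p : MultiRate} (hinv : p.invs = []) (m m' : Fin p.numModes)
    (ν ν' : Fin p.numVars → ℝ) (t : ℝ≥0) (a : Fin p.numActs) :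
    p.toHybridKripke.toKripke.graph.Trans (m, ν) (t, a) (m', ν') ↔
      ∃ d ∈ p.edges, d.source = m ∧ d.action = a ∧ d.target = m' ∧
        (fun x : Fin p.numVars => ν x + t * (p.rate m x : ℝ)) ∈ d.guard.toSet p.numVars ∧
        ((fun x : Fin p.numVars => ν x + t * (p.rate m x : ℝ)), ν') ∈
          resetJump d.resets p.numVars := by
  have hI : ∀ i : Fin p.numModes, ∀ μ, μ ∈ p.toHybridKripke.inv i := fun i μ k hk => by
    simp [hinv] at hk
  constructor
  · rintro ⟨e, ⟨d, hd, h1, h2, h3, h4, h5⟩, rfl, rfl, rfl, f, hf, h6, -, h7, -⟩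
    have hft := IsFlowSolution.eq_of_const (X := Fin p.numVars) hf t.2
    refine ⟨d, hd, h1.symm, h3.symm, h5.symm, ?_, ?_⟩
    · rw [← h2]
      exact hft ▸ h6
    · rw [← h4]
      exact hft ▸ h7
  · rintro ⟨d, hd, h1, h2, h3, h4, h5⟩
    exact ⟨⟨m, d.guard.toSet p.numVars, a, resetJump d.resets p.numVars, m'⟩,
      ⟨d, hd, h1.symm, rfl, h2.symm, rfl, h3.symm⟩, rfl, rfl, rfl, _,
      isFlowSolution_const (X := Fin p.numVars) _ ν, h4, fun _ _ => hI _ _, h5, hI _ _⟩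

/-! ### Instructions as flows of unit duration -/

namespace CounterAct

/-- The instruction uses only registers below `B`. -/
def Bounded (B : ℕ) : CounterAct → Prop
  | nop => True
  | inc x => x < B
  | dec x => x < B
  | isZero x => x < B
  | clear x => x < B

theorem Bounded.mono {a : CounterAct} {B C : ℕ} (h : a.Bounded B) (hBC : B ≤ C) :
    a.Bounded C := by
  cases a <;> first | trivial | exact lt_of_lt_of_le h hBC

theorem exists_bounded (a : CounterAct) : ∃ B, a.Bounded B := by
  cases a with
  | nop => exact ⟨0, trivial⟩
  | inc x => exact ⟨x + 1, Nat.lt_succ_self x⟩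
  | dec x => exact ⟨x + 1, Nat.lt_succ_self x⟩
  | isZero x => exact ⟨x + 1, Nat.lt_succ_self x⟩
  | clear x => exact ⟨x + 1, Nat.lt_succ_self x⟩

/-- The change of a register while an instruction is executed by a flow. -/
def delta : CounterAct → ℕ → ℤ
  | inc x, y => if y = x then 1 else 0
  | dec x, y => if y = x then -1 else 0
  | _, _ => 0

/-- The rates of the clock (variable `0`) and of the registers. -/
def rates (a : CounterAct) (B : ℕ) : List ℤ := 1 :: (List.range B).map a.delta

/-- The guard at the end of an instruction, which takes one unit of time. -/
def guard : CounterAct → RectPred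
  | dec x => [(0, .eq, 1), (x + 1, .ge, 0)]
  | isZero x => [(0, .eq, 1), (x + 1, .eq, 0)]
  | _ => [(0, .eq, 1)]

/-- The resets at the end of an instruction. -/
def resets : CounterAct → List (ℕ × ℤ)
  | clear x => [(0, 0), (x + 1, 0)]
  | _ => [(0, 0)]

end CounterAct

/-- The valuation of a clock with value `0` and registers with contents `s`. -/
def regVal (B : ℕ) (s : ℕ → ℕ) : Fin (B + 1) → ℝ := Fin.cons 0 fun x => (s x : ℝ)

namespace CounterAct

theorem mem_guard_iff (a : CounterAct) {B : ℕ} (ν : Fin (B + 1) → ℝ) :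
    ν ∈ a.guard.toSet (B + 1) ↔ ν 0 = 1 ∧ ∀ x : Fin B,
      (a = .dec x → 0 ≤ ν x.succ) ∧ (a = .isZero x → ν x.succ = 0) := by
  cases a <;> simp [guard, RectPred.toSet, Cmp.Holds, Fin.forall_fin_succ, eq_comm]

theorem mem_resets_iff (a : CounterAct) {B : ℕ} (ν ν' : Fin (B + 1) → ℝ) :
    (ν, ν') ∈ resetJump a.resets (B + 1) ↔ ν' 0 = 0 ∧ ∀ x : Fin B,
      (a = .clear x → ν' x.succ = 0) ∧ (a ≠ .clear x → ν' x.succ = ν x.succ) := by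
  cases a <;> simp [resets, resetJump, Fin.forall_fin_succ, eq_comm]

/-- The flow of duration `t` in a mode with the rates of `a`. -/
def flowVal (a : CounterAct) (B : ℕ) (s : ℕ → ℕ) (t : ℝ) : Fin (B + 1) → ℝ :=
  fun x => regVal B s x + t * ((a.rates B).getD x 0 : ℤ)

theorem flowVal_zero (a : CounterAct) (B : ℕ) (s : ℕ → ℕ) (t : ℝ) : a.flowVal B s t 0 = t := by
  simp [flowVal, regVal, rates]

theorem flowVal_succ (a : CounterAct) (B : ℕ) (s : ℕ → ℕ) (t : ℝ) (x : Fin B) :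
    a.flowVal B s t x.succ = s x + t * a.delta x := by
  simp [flowVal, regVal, rates]

/-- The clock starts at 0 and the guard wants 1, so exactly one time unit passes and each register
changes by its `delta`. Nonnegativity after a decrement means that the register was positive before.
Boundedness matters for the tests: a constraint on a variable out of range would be ignored. -/
theorem exists_rel_of_flow (a : CounterAct) {B : ℕ} (ha : a.Bounded B) {s : ℕ → ℕ} {t : ℝ}
    {ν' : Fin (B + 1) → ℝ} (h1 : a.flowVal B s t ∈ a.guard.toSet (B + 1))
    (h2 : (a.flowVal B s t, ν') ∈ resetJump a.resets (B + 1)) :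
    ∃ s', a.Rel s s' ∧ ν' = regVal B s' := by
  rw [mem_guard_iff] at h1
  rw [mem_resets_iff] at h2
  obtain ⟨h1, h3⟩ := h1
  obtain ⟨h2, h4⟩ := h2
  rw [flowVal_zero] at h1
  subst h1
  simp only [flowVal_succ, one_mul] at h3 h4
  have ext : ∀ s' : ℕ → ℕ, (∀ x : Fin B, ν' x.succ = s' x) → ν' = regVal B s' := fun s' h =>
    funext fun x => Fin.cases (by simpa [regVal] using h2) (fun x => by simpa [regVal] using h x) x
  cases a with
  | nop => exact ⟨s, rfl, ext _ fun x => by simpa [delta] using h4 x⟩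
  | inc y =>
    refine ⟨_, rfl, ext _ fun x => ?_⟩
    have := (h4 x).2 (by simp)
    by_cases hx : (x : ℕ) = y
    · simp [this, delta, hx]
    · simp [this, delta, hx]
  | dec y =>
    have hy := (h3 ⟨y, ha⟩).1 rfl
    have hs : 1 ≤ s y := by
      simp only [delta, if_true] at hy
      push_cast at hy
      have : (1 : ℝ) ≤ s y := by linarith
      exact_mod_cast this
    refine ⟨_, ⟨by omega, rfl⟩, ext _ fun x => ?_⟩
    have := (h4 x).2 (by simp)
    by_cases hx : (x : ℕ) = y
    · simp [this, delta, hx, Nat.cast_sub hs, sub_eq_add_neg]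
    · simp [this, delta, hx]
  | isZero y =>
    have hy := (h3 ⟨y, ha⟩).2 rfl
    exact ⟨s, ⟨by simpa [delta] using hy, rfl⟩, ext _ fun x => by simpa [delta] using h4 x⟩
  | clear y =>
    refine ⟨_, rfl, ext _ fun x => ?_⟩
    by_cases hx : (x : ℕ) = y
    · simp [(h4 x).1 (by simp [hx]), hx]
    · have := (h4 x).2 (by simpa using fun h => hx h.symm)
      simp [this, delta, hx]

theorem flow_of_rel (a : CounterAct) {B : ℕ} (ha : a.Bounded B) {s s' : ℕ → ℕ}
    (h : a.Rel s s') : a.flowVal B s 1 ∈ a.guard.toSet (B + 1) ∧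
      (a.flowVal B s 1, regVal B s') ∈ resetJump a.resets (B + 1) := by
  rw [mem_guard_iff, mem_resets_iff]
  simp only [flowVal_zero, flowVal_succ, one_mul, true_and]
  have h0 : regVal B s' 0 = 0 := rfl
  have hs : ∀ x : Fin B, regVal B s' x.succ = s' x := fun x => by simp [regVal]
  simp only [h0, hs, true_and]
  cases a with
  | nop =>
    obtain rfl : s' = s := h
    simp [delta]
  | inc y =>
    obtain rfl : s' = _ := h
    refine ⟨by simp, fun x => ?_⟩
    by_cases hx : (x : ℕ) = y <;> simp [delta, hx]
  | dec y =>
    obtain ⟨h, rfl⟩ := h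
    have hs : 1 ≤ s y := by omega
    have hs' : (1 : ℝ) ≤ s y := by exact_mod_cast hs
    refine ⟨fun x => ?_, fun x => ?_⟩
    · refine ⟨fun hx => ?_, by simp⟩
      cases hx
      simpa [delta] using hs'
    · by_cases hx : (x : ℕ) = y <;> simp [delta, hx, Nat.cast_sub hs, sub_eq_add_neg]
  | isZero y =>
    obtain ⟨h, rfl⟩ := h
    refine ⟨fun x => ⟨by simp, fun hx => ?_⟩, fun x => by simp [delta]⟩
    cases hx
    simpa [delta] using h
  | clear y =>
    obtain rfl : s' = _ := h
    refine ⟨by simp, fun x => ⟨fun hx => ?_, fun hx => ?_⟩⟩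
    · cases hx
      simp
    · have : (x : ℕ) ≠ y := fun h => hx (by rw [h])
      simp [delta, this]

end CounterAct

/-! ## From flowcharts to multi-rate structures -/

/-- The loop at `b` prolongs a finite path forever, as needed when only infinite or maximal runs
count. -/
theorem exists_sequence_of_reflTransGen {α : Type*} {r : α → α → Prop} {a b : α}
    (h : Relation.ReflTransGen r a b) (hb : r b b) :
    ∃ c : ℕ → α, c 0 = a ∧ (∃ n, c n = b) ∧ ∀ i, r (c i) (c (i + 1)) := by
  induction h using Relation.ReflTransGen.head_induction_on with
  | refl => exact ⟨fun _ => b, rfl, ⟨0, rfl⟩, fun _ => hb⟩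
  | @head a a' h _ ih =>
    obtain ⟨c, rfl, ⟨n, hn⟩, hc⟩ := ih
    exact ⟨fun i => Nat.casesOn i a c, rfl, ⟨n + 1, hn⟩, fun i => by cases i <;> simp [h, hc]⟩

namespace Flowchart

open Classical in
/-- The descriptions of the transitions between the nodes of a flowchart, where the node `i` becomes
the mode `e i + 1` and the final node gets a loop. -/
noncomputable def edgeList (F : Flowchart) {N : ℕ} (e : F.Node ≃ Fin N) : List MultiRateEdge :=
  ((List.finRange N ×ˢ List.finRange N).filter fun p =>
      F.Edge (e.symm p.1) (e.symm p.2) ∨ (e.symm p.1 = F.final ∧ e.symm p.2 = F.final)).map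
    fun p => ⟨p.1 + 1, (F.act (e.symm p.1)).guard, 0, (F.act (e.symm p.1)).resets, p.2 + 1⟩

theorem mem_edgeList {F : Flowchart} {N : ℕ} {e : F.Node ≃ Fin N} {d : MultiRateEdge} :
    d ∈ F.edgeList e ↔ ∃ i j, (F.Edge i j ∨ (i = F.final ∧ j = F.final)) ∧
      d = ⟨e i + 1, (F.act i).guard, 0, (F.act i).resets, e j + 1⟩ := by
  simp only [edgeList, List.mem_map, List.mem_filter, decide_eq_true_eq, Prod.exists]
  constructor
  · rintro ⟨i, j, ⟨-, h⟩, rfl⟩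
    exact ⟨_, _, h, by simp⟩
  · rintro ⟨i, j, h, rfl⟩
    exact ⟨e i, e j, ⟨by simp [List.mem_product], by simpa using h⟩, by simp⟩

open Classical in
/-- The multi-rate structure that writes `n` into register `0` and then executes a flowchart with
registers below `B`.  The mode of the final node has the label `0`. -/
noncomputable def toMultiRate (F : Flowchart) {N : ℕ} (e : F.Node ≃ Fin N) (B n : ℕ) :
    MultiRate where
  numModes := N + 1
  numActs := 1
  numVars := B + 1
  initModes := [0]
  edges := ⟨0, [], 0, [(1, (n : ℤ))], e F.start + 1⟩ :: F.edgeList e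
  invs := []
  rates := [] :: List.ofFn fun i => (F.act (e.symm i)).rates B
  props := [0]
  labels := [] :: List.ofFn fun i => if e.symm i = F.final then [0] else []

variable {F : Flowchart} {N : ℕ} {e : F.Node ≃ Fin N} {B n : ℕ}

theorem rate_toMultiRate_succ (i : F.Node) (x : ℕ) :
    (F.toMultiRate e B n).rate (e i).succ x = ((F.act i).rates B).getD x 0 := by
  simp [MultiRate.rate, toMultiRate]

theorem rate_toMultiRate_zero (x : ℕ) : (F.toMultiRate e B n).rate 0 x = 0 := by
  simp [MultiRate.rate, toMultiRate]

/-- The states of the structure. -/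
abbrev StateOf (_F : Flowchart) (N B : ℕ) : Type := Fin (N + 1) × (Fin (B + 1) → ℝ)

/-- The transition graph of the structure. -/
noncomputable abbrev graphOf (F : Flowchart) (e : F.Node ≃ Fin N) (B n : ℕ) :
    TransitionGraph (F.StateOf N B) (ℝ≥0 × Fin 1) :=
  (F.toMultiRate e B n).toHybridKripke.toKripke.graph

theorem trans_of_step (hB : ∀ i, (F.act i).Bounded B) {p q : F.Node × (ℕ → ℕ)}
    (h : F.Step p q ∨ (p.1 = F.final ∧ q = p)) :
    (F.graphOf e B n).Trans ((e p.1).succ, regVal B p.2) (1, 0)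
      ((e q.1).succ, regVal B q.2) := by
  have h1 : (F.Edge p.1 q.1 ∨ (p.1 = F.final ∧ q.1 = F.final)) ∧ (F.act p.1).Rel p.2 q.2 := by
    rcases h with ⟨h, h'⟩ | ⟨h, rfl⟩
    · exact ⟨.inl h, h'⟩
    · refine ⟨.inr ⟨h, h⟩, ?_⟩
      rw [h, F.act_final]
      rfl
  obtain ⟨h2, h3⟩ := CounterAct.flow_of_rel _ (hB p.1) h1.2
  refine (MultiRate.trans_iff (p := F.toMultiRate e B n) rfl _ _ _ _ _ _).2
    ⟨_, List.mem_cons_of_mem _ (mem_edgeList.2 ⟨p.1, q.1, h1.1, rfl⟩), rfl, rfl, rfl, ?_⟩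
  simp only [rate_toMultiRate_succ]
  exact ⟨h2, h3⟩

theorem step_of_trans (hB : ∀ i, (F.act i).Bounded B) {i : F.Node} {s : ℕ → ℕ}
    {l : ℝ≥0 × Fin 1} {c : F.StateOf N B}
    (h : (F.graphOf e B n).Trans ((e i).succ, regVal B s) l c) :
    ∃ q : F.Node × (ℕ → ℕ), (F.Step (i, s) q ∨ (i = F.final ∧ q = (i, s))) ∧
      c = ((e q.1).succ, regVal B q.2) := by
  obtain ⟨m, ν⟩ := c
  obtain ⟨d, hd, h1, -, h2, h3, h4⟩ :=
    (MultiRate.trans_iff (p := F.toMultiRate e B n) rfl _ _ _ _ _ _).1 h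
  rcases List.mem_cons.1 hd with rfl | hd
  · simp at h1
  obtain ⟨i', j, hij, rfl⟩ := mem_edgeList.1 hd
  obtain rfl : i' = i := by
    simp only [Fin.val_succ, Nat.add_right_cancel_iff] at h1
    exact e.injective (Fin.ext h1)
  obtain rfl : (e j).succ = m := Fin.ext h2
  simp only [rate_toMultiRate_succ] at h3 h4
  obtain ⟨s', h5, rfl⟩ := CounterAct.exists_rel_of_flow _ (hB i') h3 h4
  refine ⟨(j, s'), ?_, rfl⟩
  rcases hij with hij | ⟨hi, hj⟩
  · exact .inl ⟨hij, h5⟩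
  · refine .inr ⟨hi, ?_⟩
    rw [hi, F.act_final] at h5
    obtain rfl : s' = s := h5
    rw [hi, hj]

/-- The initial contents of the registers. -/
def input (n : ℕ) : ℕ → ℕ := Function.update (fun _ => 0) 0 n

theorem mem_init_iff (c : F.StateOf N B) :
    c ∈ (F.graphOf e B n).init ↔ c = (0, fun _ => 0) := by
  obtain ⟨m, ν⟩ := c
  constructor
  · rintro ⟨h1, h2, -⟩
    have h1 : (m : ℕ) ∈ [0] := h1
    refine Prod.ext (Fin.ext (by simpa using h1)) h2
  · intro h
    cases h
    refine ⟨?_, rfl, fun k hk => ?_⟩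
    · change _ ∈ [0]
      simp
    · change k ∈ [] at hk
      simp at hk

/-- Variable `1` is register `0`; positivity of `B` ensures that it exists, since otherwise the
reset would be ignored. -/
theorem mem_inputJump_iff (hB : 0 < B) (ν : Fin (B + 1) → ℝ) :
    (fun _ => 0, ν) ∈ resetJump [(1, (n : ℤ))] (B + 1) ↔ ν = regVal B (input n) := by
  obtain ⟨B, rfl⟩ := Nat.exists_eq_succ_of_ne_zero hB.ne'
  simp only [resetJump, Set.mem_ofPred_eq, funext_iff, regVal, input]
  simp [Fin.forall_fin_succ]

theorem trans_input (hB : 0 < B) :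
    (F.graphOf e B n).Trans (0, fun _ => 0) (0, 0) ((e F.start).succ, regVal B (input n)) := by
  refine (MultiRate.trans_iff (p := F.toMultiRate e B n) rfl _ _ _ _ _ _).2
    ⟨_, List.mem_cons_self, rfl, rfl, rfl, by simp [RectPred.toSet], ?_⟩
  simp only [NNReal.coe_zero, zero_mul, add_zero]
  exact (mem_inputJump_iff hB _).2 rfl

/-- All rates vanish in mode `0`, so the time spent there is irrelevant. -/
theorem eq_of_trans_input (hB : 0 < B) {l : ℝ≥0 × Fin 1} {c : F.StateOf N B}
    (h : (F.graphOf e B n).Trans (0, fun _ => 0) l c) :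
    c = ((e F.start).succ, regVal B (input n)) := by
  obtain ⟨m, ν⟩ := c
  obtain ⟨d, hd, h1, -, h2, -, h4⟩ :=
    (MultiRate.trans_iff (p := F.toMultiRate e B n) rfl _ _ _ _ _ _).1 h
  rcases List.mem_cons.1 hd with rfl | hd
  · have hr : ∀ x, (F.toMultiRate e B n).rate ((0 : Fin (N + 1)) : ℕ) x = 0 :=
      rate_toMultiRate_zero
    refine Prod.ext (Fin.ext h2.symm) ((mem_inputJump_iff hB ν).1 ?_)
    simp only [hr, Int.cast_zero, mul_zero, add_zero] at h4
    exact h4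
  · obtain ⟨i, j, -, rfl⟩ := mem_edgeList.1 hd
    exact absurd h1 (Nat.succ_ne_zero _)

theorem zero_mem_label_succ (i : F.Node) (ν : Fin (B + 1) → ℝ) :
    0 ∈ (F.toMultiRate e B n).toHybridKripke.toKripke.label
      (((e i).succ, ν) : F.StateOf N B) ↔ i = F.final := by
  change 0 ∈ [0] ∧ 0 ∈ List.getD (_ :: List.ofFn _) ((e i).succ : ℕ) [] ↔ _
  by_cases h : i = F.final <;> simp [h]

theorem zero_notMem_label_zero (ν : Fin (B + 1) → ℝ) :
    0 ∉ (F.toMultiRate e B n).toHybridKripke.toKripke.label ((0, ν) : F.StateOf N B) := by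
  change ¬ (0 ∈ [0] ∧ 0 ∈ List.getD (_ :: _) ((0 : Fin (N + 1)) : ℕ) [])
  simp

/-- No admissible run visits the label `0` if and only if the flowchart does not reach its final
node. -/
theorem models_iff (hB0 : 0 < B) (hB : ∀ i, (F.act i).Bounded B) (r : RunKind) (u : UntilKind) :
    (F.toMultiRate e B n).toHybridKripke.Models r u (.neg (.untl .tt (.atom 0))) ↔
      ¬ ∃ t, F.Rel (input n) t := by
  constructor
  · rintro h ⟨t, ht⟩
    let T : F.StateOf N B → F.StateOf N B → Prop := fun c d =>
      ∃ l, (F.graphOf e B n).Trans c l d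
    have h1 : Relation.ReflTransGen T ((e F.start).succ, regVal B (input n))
        ((e F.final).succ, regVal B t) :=
      Relation.ReflTransGen.lift (p := T)
        (fun p : F.Node × (ℕ → ℕ) => ((e p.1).succ, regVal B p.2))
        (fun _ _ hpq => ⟨_, trans_of_step hB (.inl hpq)⟩) _ _ ht
    have h2 := Relation.ReflTransGen.head (r := T) ⟨_, trans_input hB0⟩ h1
    obtain ⟨c, hc0, ⟨k, hk⟩, hc⟩ := exists_sequence_of_reflTransGen h2
      ⟨_, trans_of_step (p := (F.final, t)) (q := (F.final, t)) hB (.inr ⟨rfl, rfl⟩)⟩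
    choose l hl using hc
    let ρ : (F.graphOf e B n).Run :=
      ⟨⊤, c, fun i _ => l i, (mem_init_iff _).2 hc0, fun i _ => hl i⟩
    have hρ : r.Admits ρ := by
      cases r with
      | all => trivial
      | infinite => rfl
      | maximal => exact fun m hm => absurd hm (ENat.top_ne_natCast m)
    refine h ρ hρ ⟨k, ?_, le_top, ?_, fun _ _ => trivial⟩
    -- The run starts in mode `0`, not in the final mode, so the witness lies strictly in the future
    -- and serves both readings of until.
    · have : k ≠ 0 := by
        rintro rfl
        rw [hc0] at hk
        exact (Fin.succ_ne_zero (e F.final)) (congrArg Prod.fst hk).symm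
      cases u <;> simp only [UntilKind.least] <;> omega
    · change 0 ∈ (F.toMultiRate e B n).toHybridKripke.toKripke.label (c (0 + k))
      rw [zero_add, hk]
      exact (zero_mem_label_succ F.final _).2 rfl
  -- Admissibility is dropped: no run whatsoever, even a finite one, can reach the label without a
  -- halting computation.
  · rintro h ρ - ⟨k, -, hk, h1, -⟩
    have key : ∀ i : ℕ, (i : ℕ∞) ≤ ρ.last → ρ.state i = ((0, fun _ => 0) : F.StateOf N B) ∨
        ∃ q : F.Node × (ℕ → ℕ), ρ.state i = (((e q.1).succ, regVal B q.2) : F.StateOf N B) ∧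
          Relation.ReflTransGen F.Step (F.start, input n) q := by
      intro i
      induction i with
      | zero => exact fun _ => .inl ((mem_init_iff _).1 ρ.start)
      | succ i ih =>
        intro hi
        have hi' : (i : ℕ∞) < ρ.last :=
          lt_of_lt_of_le (by exact_mod_cast Nat.lt_succ_self i) hi
        have hs : (F.graphOf e B n).Trans _ _ _ := ρ.step i hi'
        rcases ih hi'.le with h0 | ⟨q, hq, hq'⟩
        · rw [h0] at hs
          exact .inr ⟨(F.start, input n), eq_of_trans_input hB0 hs, .refl⟩
        · rw [hq] at hs
          obtain ⟨q', h2 | ⟨-, rfl⟩, h3⟩ := step_of_trans hB hs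
          · exact .inr ⟨q', h3, hq'.tail h2⟩
          · exact .inr ⟨q, h3, hq'⟩
    change 0 ∈ (F.toMultiRate e B n).toHybridKripke.toKripke.label (ρ.state (0 + k)) at h1
    rcases key (0 + k) hk with h2 | ⟨⟨i, t⟩, h2, h3⟩
    · rw [h2] at h1
      exact zero_notMem_label_zero _ h1
    · rw [h2] at h1
      obtain rfl := (zero_mem_label_succ i _).1 h1
      exact h ⟨t, h3⟩

/-! ### Computability of the reduction and the main theorem -/

/-- Only the reset on the input edge depends on `n`. Everything else, including the parts chosen
classically, is a constant once `F`, `e` and `B` are fixed. -/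
theorem computable_toMultiRate (F : Flowchart) (e : F.Node ≃ Fin N) (B : ℕ) :
    Computable (F.toMultiRate e B) := by
  -- The integer `n` is encoded as `2 * n`.
  have h0 : Primrec fun n : ℕ => (n : ℤ) :=
    Primrec.encode_iff.1 (Primrec.nat_mul.comp (Primrec.const 2) Primrec.id)
  have h1 : Primrec fun n : ℕ => [(1, (n : ℤ))] :=
    Primrec.list_cons.comp ((Primrec.const 1).pair h0) (Primrec.const [])
  have h2 : Primrec fun n : ℕ =>
      MultiRateEdge.equivProd.symm (0, [], 0, [(1, (n : ℤ))], e F.start + 1) :=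
    Primrec.of_equiv_symm.comp ((Primrec.const 0).pair ((Primrec.const []).pair
      ((Primrec.const 0).pair (h1.pair (Primrec.const _)))))
  have h3 : Primrec fun n : ℕ => (F.toMultiRate e B n).edges :=
    Primrec.list_cons.comp h2 (Primrec.const _)
  have h4 : Primrec fun n : ℕ => (MultiRate.equivProd (F.toMultiRate e B n)).2.2.2.2.2 :=
    Primrec.const (MultiRate.equivProd (F.toMultiRate e B 0)).2.2.2.2.2
  have h5 : Primrec fun n : ℕ => MultiRate.equivProd.symm
      (MultiRate.equivProd (F.toMultiRate e B n)) :=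
    Primrec.of_equiv_symm.comp ((Primrec.const _).pair ((Primrec.const _).pair
      ((Primrec.const _).pair ((Primrec.const _).pair (h3.pair h4)))))
  exact h5.to_comp

theorem exists_bounded (F : Flowchart) : ∃ B, 0 < B ∧ ∀ i, (F.act i).Bounded B := by
  have := F.fintypeNode
  choose b hb using fun i => (F.act i).exists_bounded
  exact ⟨Finset.univ.sup b + 1, Nat.succ_pos _, fun i =>
    (hb i).mono ((Finset.le_sup (Finset.mem_univ i)).trans (Nat.le_succ _))⟩

end Flowchart

/-- The LTL model-checking problem for hybrid Kripke structures is undecidable.  The hybrid Kripke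
structures are given by finite codes from a type `C`, where `den c` is the structure denoted by the
code `c`; any such effective presentation is allowed in which at least the multi-rate structures can
be written down effectively (for example `C = MultiRate` itself).  No computable function decides
correctly, for all codes `c` and all formulas `φ` over the propositions of `den c`, whether
`den c ⊨ φ`; this holds under each of the usual conventions on runs and on the until operator. -/
theorem theorem1 {C : Type*} [Primcodable C] (den : C → HybridKripke)
    (write : MultiRate → C) (hwrite : Computable write)
    (hden : ∀ p : MultiRate, den (write p) = p.toHybridKripke)
    (r : RunKind) (u : UntilKind) :
    ¬ ∃ f : C × LTL → Bool, Computable f ∧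
      ∀ (c : C) (φ : LTL), φ.atoms ⊆ (den c).props →
        (f (c, φ) = true ↔ (den c).Models r u φ) := by
  rintro ⟨f, hf, hfm⟩
  obtain ⟨P, hP⟩ := CounterProg.exists_undecidable
  obtain ⟨F, hF⟩ := Flowchart.exists_of_counterProg P
  obtain ⟨B, hB0, hB⟩ := F.exists_bounded
  have := F.fintypeNode
  let e := Fintype.equivFin F.Node
  -- The formula holds exactly when the program does not halt, so the negated answer would decide
  -- halting.
  have hc : Computable fun n : ℕ =>
      !f (write (F.toMultiRate e B n), .neg (.untl .tt (.atom 0))) :=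
    Primrec.not.to_comp.comp (hf.comp ((hwrite.comp (F.computable_toMultiRate e B)).pair
      (Computable.const _)))
  refine hP (ComputablePred.computable_iff.2 ⟨_, hc, funext fun n => propext ?_⟩)
  have h1 := hfm (write (F.toMultiRate e B n)) (.neg (.untl .tt (.atom 0))) (by
    rw [hden]
    simp [LTL.atoms, MultiRate.toHybridKripke, Flowchart.toMultiRate])
  rw [hden, Flowchart.models_iff hB0 hB, hF] at h1
  rw [Bool.not_eq_true', ← Bool.not_eq_true, h1, not_not]
  rfl
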